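/- Fix $d\in\{1,2,\dots\}$ and let $\mathbb F=\{0,1,2,\dots\}\times\{1,\dots,d\}$. For a stochastic matrix $S=(s(k,i;l,j))$ on $\mathbb F$ say that $S$ is block-monotone if $\sum_{m\ge l}s(k,i;m,j)\le\sum_{m\ge l}s(k+1,i;m,j)$ for all $k,l\ge 0$ and all $i,j$. For two stochastic matrices write $S_1\prec_d S_2$ if $\sum_{m\ge l}s_1(k,i;m,j)\le\sum_{m\ge l}s_2(k,i;m,j)$ for all $k,l\ge0$ and all $i,j$. For $n\ge1$ the last-column-block-augmented truncation ${}_{(n)}P_n$ of a stochastic matrix $P=(p(k,i;l,j))$ has entries $p(k,i;l,j)$ for $l<n$, $\sum_{m\ge n}p(k,i;m,j)$ for $l=n$, and $0$ for $l>n$. Let $P$ and $\widetilde P=(\widetilde p(k,i;l,j))$ be stochastic matrices on $\mathbb F$ such that (i) $\widetilde P$ is block-monotone and irreducible; (ii) $P\prec_d\widetilde P$. Suppose that there are a vector $v':\mathbb F\to[1,\infty)$ with $v'(k,i)\le v'(k+1,i)$ for all $(k,i)\in\mathbb F$, and numbers $\gamma'\in(0,1)$, $b'\in(0,\infty)$,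 $K\in\{0,1,2,\dots\}$, such that for all $(k,i)\in\mathbb F$ $$\sum_{(l,j)\in\mathbb F}\widetilde p(k,i;l,j)\,v'(l,j)\le\gamma' v'(k,i)+b'\,1_{\{k\le K\}},$$ and such that $\sum_{j=1}^d\widetilde p(K,i;0,j)>0$ for all $i\in\{1,\dots,d\}$. Then there exists $B\in(0,\infty)$ with $$B\sum_{j=1}^d\widetilde p(K,i;0,j)\ge b'\qquad\text{for all }i\in\{1,\dots,d\},$$ and for every such $B$ the following holds. Put $$\gamma=\frac{\gamma'+B}{1+B},\qquad b=b'+B,\qquad v(0,i)=v'(0,i),\qquad v(k,i)=v'(k,i)+B\quad(k\ge1).$$ Then, for every stationary probability vector $\pi$ of $P$ (which exists, and is unique, if for instance $P$ is irreducible and positive recurrent), every $n\ge1$, every stationary probability vector ${}_{(n)}\pi_n$ of ${}_{(n)}P_n$, and every $m\ge1$, $$\sum_{(k,i)\in\mathbb F}\bigl|{}_{(n)}\pi_n(k,i)-\pi(k,i)\bigr|\le\frac{b}{1-\gamma}\left(4\gamma^m+2m\sum_{i=1}^d\frac1{v(n,i)}\right).$$ -/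

import Mathlib

noncomputable section

namespace BlockMC

/-- The state space `ℤ₊ × {1, …, d}`: the first coordinate is the level, the second one the phase. -/
abbrev State (d : ℕ) : Type := ℕ × Fin d

/-- Nonnegative entries, every row sums to one. -/
structure IsStochastic {d : ℕ} (P : Matrix (State d) (State d) ℝ) : Prop where
  nonneg : ∀ x y, 0 ≤ P x y
  hasSum_row : ∀ x, HasSum (fun y => P x y) 1

/-- `blockTail P x l j = ∑_{m ≥ l} p(x; m, j)`, the `(x, (l, j))` entry of `P T_d`, where `T_d` is
the block lower triangular matrix of identity blocks. -/
def blockTail {d : ℕ} (P : Matrix (State d) (State d) ℝ) (x : State d) (l : ℕ) (j : Fin d) : ℝ :=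
  ∑' m : ℕ, P x (l + m, j)

/-- Block-monotone stochastic matrices with block size `d`. -/
structure IsBlockMonotone {d : ℕ} (S : Matrix (State d) (State d) ℝ) : Prop where
  stochastic : IsStochastic S
  mono : ∀ (k l : ℕ) (i j : Fin d), blockTail S (k, i) l j ≤ blockTail S (k + 1, i) l j

/-- Block-wise dominance `P₁ ≺_d P₂`, i.e. `P₁ T_d ≤ P₂ T_d` entrywise. -/
def BlockDominated {d : ℕ} (P₁ P₂ : Matrix (State d) (State d) ℝ) : Prop :=
  ∀ (x : State d) (l : ℕ) (j : Fin d), blockTail P₁ x l j ≤ blockTail P₂ x l j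

/-- Block-increasing column vectors. -/
def IsBlockIncreasing {d : ℕ} (f : State d → ℝ) : Prop :=
  ∀ (k : ℕ) (i : Fin d), f (k, i) ≤ f (k + 1, i)

/-- The last-column-block-augmented first-`n`-block-column truncation of `P`. -/
def lastColTrunc {d : ℕ} (n : ℕ) (P : Matrix (State d) (State d) ℝ) :
    Matrix (State d) (State d) ℝ := fun x y =>
  if y.1 < n then P x y
  else if y.1 = n then ∑' m : ℕ, P x (n + m, y.2)
  else 0

/-- `π` is a stationary probability vector of `P`. -/
structure IsStationary {d : ℕ} (P : Matrix (State d) (State d) ℝ) (π : State d → ℝ) : Prop where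
  nonneg : ∀ x, 0 ≤ π x
  hasSum_one : HasSum π 1
  invariant : ∀ y, HasSum (fun x => π x * P x y) (π y)

/-- The total variation norm `∑_x |μ(x) - η(x)|` of the difference of two probability vectors
(the series converges for these). -/
def tvDist {d : ℕ} (μ η : State d → ℝ) : ℝ := ∑' x, |μ x - η x|

/-- The drift inequality `P v ≤ γ v + b 1_K`, where `1_K` is the indicator of the levels
`0, …, K`; it includes the finiteness of every entry of `P v`. -/
def Drift {d : ℕ} (P : Matrix (State d) (State d) ℝ) (v : State d → ℝ) (γ b : ℝ) (K : ℕ) : Prop :=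
  ∀ x : State d, Summable (fun y => P x y * v y) ∧
    ∑' y, P x y * v y ≤ γ * v x + b * (if x.1 ≤ K then 1 else 0)

end BlockMC

end

namespace BlockMC

open Finset

/-! Everything is stated for the action of kernels on functions. Block dominance orders the means of
nonnegative block-increasing functions. The truncation pushes mass down to level `n`, so it is
dominated too.

Raising `v'` by `B` above level zero turns the drift condition into one with exceptional set `{0} ×
phases`. Under it the iterates of a dominated kernel on `f`, `|f| ≤ 1`, forget the initial level:
their oscillation over levels `0, …, k` in phase `i` is at most `2 γ^m v(k, i)`. This is the
analytic form of a monotone coupling in which ordered chains merge once the dominating one reaches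
level zero; running maxima along the levels replace the coupling.

The total variation distance is a difference of means of one sign function `f`. Replace each
stationary mean by the mean of the `m`-th iterate started at level zero in the same phase. Since the
drift gives stationary mean of `v` at most `b / (1 - γ)`, the two replacements cost `4 γ^m b / (1 -
γ)`. The level-zero quantities depend only on the phase marginals. These agree: block monotonicity
makes the phase an autonomous chain with one law for all dominated kernels, and irreducibility makes
its stationary law unique.

It remains to compare `m` steps of `P` and of its truncation from the same state. Each step errs
only by the mass above level `n`, where `1 ≤ v * ∑ i, 1 / v (n, i)`; the drift sums these errors to
the term linear in `m`. -/

/-- The integral `∑_y a(y) f(y)` of a function against a weight vector. -/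
noncomputable def mean {d : ℕ} (a f : State d → ℝ) : ℝ := ∑' y, a y * f y

/-- Probability vectors. -/
structure IsProb {d : ℕ} (a : State d → ℝ) : Prop where
  nonneg : ∀ y, 0 ≤ a y
  hasSum_one : HasSum a 1

/-! ### Means against probability vectors -/

section mean

variable {d : ℕ} {a c f g : State d → ℝ} {C : ℝ}

theorem IsProb.summable_mul (ha : IsProb a) (hf : ∀ y, |f y| ≤ C) :
    Summable fun y => a y * f y := by
  refine Summable.of_norm_bounded (ha.hasSum_one.summable.mul_right C) fun y => ?_
  rw [Real.norm_eq_abs, abs_mul, abs_of_nonneg (ha.nonneg y)]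
  exact mul_le_mul_of_nonneg_left (hf y) (ha.nonneg y)

theorem IsProb.summable_const (ha : IsProb a) (C : ℝ) : Summable fun y => a y * C :=
  ha.hasSum_one.summable.mul_right C

theorem IsProb.mean_const (ha : IsProb a) (C : ℝ) : mean a (fun _ => C) = C := by
  simpa [mean] using (ha.hasSum_one.mul_right C).tsum_eq

theorem mean_mono (ha : ∀ y, 0 ≤ a y) (hf : Summable fun y => a y * f y)
    (hg : Summable fun y => a y * g y) (h : ∀ y, f y ≤ g y) : mean a f ≤ mean a g :=
  hf.tsum_le_tsum (fun y => mul_le_mul_of_nonneg_left (h y) (ha y)) hg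

theorem summable_mul_add (hf : Summable fun y => a y * f y)
    (hg : Summable fun y => a y * g y) : Summable fun y => a y * (f y + g y) := by
  simpa only [mul_add] using hf.add hg

theorem mean_add (hf : Summable fun y => a y * f y) (hg : Summable fun y => a y * g y) :
    mean a (fun y => f y + g y) = mean a f + mean a g := by
  simp only [mean, mul_add]
  exact hf.tsum_add hg

theorem mean_sub (hf : Summable fun y => a y * f y) (hg : Summable fun y => a y * g y) :
    mean a (fun y => f y - g y) = mean a f - mean a g := by
  simp only [mean, mul_sub]
  exact hf.tsum_sub hg

theorem mean_const_mul (r : ℝ) : mean a (fun y => r * f y) = r * mean a f := by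
  simp only [mean, ← tsum_mul_left]
  exact tsum_congr fun y => by ring

theorem summable_mul_const_mul (hf : Summable fun y => a y * f y) (r : ℝ) :
    Summable fun y => a y * (r * f y) :=
  (hf.mul_left r).congr fun y => by ring

theorem summable_mul_of_abs_le (ha : ∀ y, 0 ≤ a y) (hg : Summable fun y => a y * g y)
    (h : ∀ y, |f y| ≤ g y) : Summable fun y => a y * f y := by
  refine Summable.of_norm_bounded hg fun y => ?_
  rw [Real.norm_eq_abs, abs_mul, abs_of_nonneg (ha y)]
  exact mul_le_mul_of_nonneg_left (h y) (ha y)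

theorem abs_mean_le_mean (ha : ∀ y, 0 ≤ a y) (hg : Summable fun y => a y * g y)
    (h : ∀ y, |f y| ≤ g y) : |mean a f| ≤ mean a g := by
  rw [← Real.norm_eq_abs, mean]
  refine tsum_of_norm_bounded hg.hasSum fun y => ?_
  rw [Real.norm_eq_abs, abs_mul, abs_of_nonneg (ha y)]
  exact mul_le_mul_of_nonneg_left (h y) (ha y)

theorem IsProb.abs_mean_le (ha : IsProb a) (hf : ∀ y, |f y| ≤ C) : |mean a f| ≤ C :=
  (abs_mean_le_mean ha.nonneg (ha.summable_const C) hf).trans_eq (ha.mean_const C)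

/-- A family over the state space is summed phase by phase. -/
theorem hasSum_of_phases {s : Fin d → ℝ} (h : ∀ j, HasSum (fun k : ℕ => f (k, j)) (s j)) :
    HasSum f (∑ j, s j) := by
  have h1 : ∀ j ∈ (univ : Finset (Fin d)),
      HasSum (fun z : State d => if z.2 = j then f z else 0) (s j) := by
    intro j _
    have hinj : Function.Injective (fun k : ℕ => ((k, j) : State d)) := fun k l hkl => by
      simpa using hkl
    rw [← hinj.hasSum_iff]
    · simpa [Function.comp_def] using h j
    · rintro ⟨k, i⟩ hz
      refine if_neg fun hij => hz ⟨k, ?_⟩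
      simp only at hij
      rw [hij]
  simpa using hasSum_sum h1

theorem summable_phase {f : State d → ℝ} (hf : Summable f) (j : Fin d) :
    Summable fun k : ℕ => f (k, j) :=
  hf.comp_injective (i := fun k : ℕ => ((k, j) : State d)) fun k l hkl => by simpa using hkl

theorem tsum_eq_sum_phases {f : State d → ℝ} (hf : Summable f) :
    ∑' z, f z = ∑ j, ∑' k : ℕ, f (k, j) :=
  (hasSum_of_phases fun j => (summable_phase hf j).hasSum).tsum_eq

end mean

/-! ### Ordered tails give ordered means -/

section tails

theorem tsum_tail_succ {a : ℕ → ℝ} (ha : Summable a) (N : ℕ) :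
    ∑' m, a (N + m) = a N + ∑' m, a (N + 1 + m) := by
  have h : Summable fun m => a (N + m) := by
    simpa only [add_comm] using (summable_nat_add_iff N).2 ha
  rw [h.tsum_eq_zero_add]
  simp only [add_zero]
  congr 1
  exact tsum_congr fun m => by congr 1; ring

/-- Summation by parts: the partial sums of `∑ a f`, completed by the tail of `a`, are ordered when
the tails of the weights are. -/
theorem sum_add_tail_le {a c f : ℕ → ℝ} (ha : Summable a) (hc : Summable c)
    (hf : Monotone f) (hf0 : 0 ≤ f 0)
    (hle : ∀ l, ∑' m, a (l + m) ≤ ∑' m, c (l + m)) (N : ℕ) :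
    ∑ l ∈ range N, a l * f l + f N * ∑' m, a (N + m) ≤
      ∑ l ∈ range N, c l * f l + f N * ∑' m, c (N + m) := by
  induction N with
  | zero => simpa using mul_le_mul_of_nonneg_left (hle 0) hf0
  | succ N ih =>
    rw [tsum_tail_succ ha, tsum_tail_succ hc] at ih
    rw [sum_range_succ, sum_range_succ]
    -- From `N` to `N + 1` each side grows by `f (N + 1) - f N` times its tail from `N + 1`.
    have h := mul_le_mul_of_nonneg_left (hle (N + 1)) (sub_nonneg.2 (hf N.le_succ))
    rw [Nat.succ_eq_add_one] at h
    linarith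

/-- The completed partial sums are ordered. On the left the tail term is nonnegative and is dropped;
on the right monotonicity of `f` bounds it by the rest of the series. -/
theorem sum_le_tsum_of_tail_le {a c f : ℕ → ℝ} (ha0 : ∀ l, 0 ≤ a l) (hc0 : ∀ l, 0 ≤ c l)
    (ha : Summable a) (hc : Summable c) (hf : Monotone f) (hf0 : 0 ≤ f 0)
    (hle : ∀ l, ∑' m, a (l + m) ≤ ∑' m, c (l + m)) (hcf : Summable fun l => c l * f l)
    (N : ℕ) : ∑ l ∈ range N, a l * f l ≤ ∑' l, c l * f l := by
  have hfN : ∀ l, 0 ≤ f l := fun l => hf0.trans (hf l.zero_le)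
  have h1 := sum_add_tail_le ha hc hf hf0 hle N
  have h2 : 0 ≤ f N * ∑' m, a (N + m) := mul_nonneg (hfN N) (tsum_nonneg fun m => ha0 _)
  have h3 : f N * ∑' m, c (N + m) ≤ ∑' m, c (m + N) * f (m + N) := by
    rw [← tsum_mul_left]
    have hs : Summable fun m => c (N + m) := by
      simpa only [add_comm] using (summable_nat_add_iff N).2 hc
    refine (hs.mul_left _).tsum_le_tsum (fun m => ?_)
      ((summable_nat_add_iff (f := fun l => c l * f l) N).2 hcf)
    rw [add_comm N m, mul_comm]
    exact mul_le_mul_of_nonneg_left (hf (Nat.le_add_left N m)) (hc0 _)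
  have h4 := hcf.sum_add_tsum_nat_add N
  linarith

theorem tsum_le_tsum_of_tail_le {a c f : ℕ → ℝ} (ha0 : ∀ l, 0 ≤ a l) (hc0 : ∀ l, 0 ≤ c l)
    (ha : Summable a) (hc : Summable c) (hf : Monotone f) (hf0 : 0 ≤ f 0)
    (hle : ∀ l, ∑' m, a (l + m) ≤ ∑' m, c (l + m)) (hcf : Summable fun l => c l * f l) :
    (Summable fun l => a l * f l) ∧ ∑' l, a l * f l ≤ ∑' l, c l * f l := by
  have h := sum_le_tsum_of_tail_le ha0 hc0 ha hc hf hf0 hle hcf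
  have h0 : ∀ l, 0 ≤ a l * f l := fun l => mul_nonneg (ha0 l) (hf0.trans (hf l.zero_le))
  exact ⟨summable_of_sum_range_le h0 h, Real.tsum_le_of_sum_range_le h0 h⟩

variable {d : ℕ}

theorem IsBlockIncreasing.monotone {f : State d → ℝ} (hf : IsBlockIncreasing f) (j : Fin d) :
    Monotone fun k : ℕ => f (k, j) :=
  monotone_nat_of_le_succ fun k => hf k j

/-- Nonnegative block-increasing functions have ordered means when the block tails are ordered. -/
theorem mean_le_mean_of_tail_le {a c f : State d → ℝ} (ha : IsProb a) (hc : IsProb c)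
    (hle : ∀ l j, ∑' m : ℕ, a (l + m, j) ≤ ∑' m : ℕ, c (l + m, j))
    (hf : IsBlockIncreasing f) (hf0 : ∀ y, 0 ≤ f y) (hcf : Summable fun y => c y * f y) :
    (Summable fun y => a y * f y) ∧ mean a f ≤ mean c f := by
  have key := fun j => tsum_le_tsum_of_tail_le (fun l => ha.nonneg (l, j))
    (fun l => hc.nonneg (l, j)) (summable_phase ha.hasSum_one.summable j)
    (summable_phase hc.hasSum_one.summable j) (hf.monotone j) (hf0 _) (fun l => hle l j)
    (summable_phase hcf j)
  have hs : Summable fun y => a y * f y :=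
    (hasSum_of_phases (f := fun y => a y * f y) fun j => (key j).1.hasSum).summable
  refine ⟨hs, ?_⟩
  rw [mean, mean, tsum_eq_sum_phases hs, tsum_eq_sum_phases hcf]
  exact sum_le_sum fun j _ => (key j).2

end tails

/-! ### The truncation as a capped kernel -/

section truncation

variable {d : ℕ}

/-- The map that lowers every level above `n` to `n`. -/
def cap {d : ℕ} (n : ℕ) (z : State d) : State d := (min z.1 n, z.2)

/-- One step of the truncation is one step of `P` followed by `cap n`. This reduces later uses of
the truncation to means under `P`. -/
theorem hasSum_lastColTrunc {P : Matrix (State d) (State d) ℝ} (n : ℕ)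
    (x : State d) {g : State d → ℝ} (hg : Summable fun y => P x y * g (cap n y)) :
    HasSum (fun y => lastColTrunc n P x y * g y) (mean (P x) (fun y => g (cap n y))) := by
  rw [mean, tsum_eq_sum_phases hg]
  refine hasSum_of_phases fun j => ?_
  have h1 : ∑' k : ℕ, P x (k, j) * g (cap n (k, j)) =
      ∑ k ∈ range (n + 1), lastColTrunc n P x (k, j) * g (k, j) := by
    rw [← (summable_phase hg j).sum_add_tsum_nat_add n, sum_range_succ]
    congr 1
    · refine sum_congr rfl fun k hk => ?_
      have hk' := mem_range.1 hk
      simp [lastColTrunc, cap, hk', min_eq_left hk'.le]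
    · simp only [lastColTrunc, cap, lt_irrefl, if_false, if_true]
      rw [← tsum_mul_right]
      exact tsum_congr fun m => by rw [add_comm m n, min_eq_right (Nat.le_add_right n m)]
  rw [h1]
  refine hasSum_sum_of_ne_finset_zero fun k hk => ?_
  have hk' : n < k := by simpa [Nat.lt_succ_iff] using hk
  simp [lastColTrunc, hk'.not_gt, hk'.ne']

theorem IsStochastic.isProb {P : Matrix (State d) (State d) ℝ} (hP : IsStochastic P)
    (x : State d) : IsProb (P x) := ⟨hP.nonneg x, hP.hasSum_row x⟩

theorem isStochastic_lastColTrunc {P : Matrix (State d) (State d) ℝ} (hP : IsStochastic P)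
    (n : ℕ) : IsStochastic (lastColTrunc n P) := by
  refine ⟨fun x y => ?_, fun x => ?_⟩
  · unfold lastColTrunc
    split_ifs
    · exact hP.nonneg _ _
    · exact tsum_nonneg fun m => hP.nonneg _ _
    · exact le_rfl
  · have h := hasSum_lastColTrunc n x (g := fun _ => 1) ((hP.isProb x).summable_const 1)
    rw [(hP.isProb x).mean_const] at h
    simpa using h

end truncation

end BlockMC

/-! ### Dominance as an order on means -/

namespace BlockMC

open Finset

/-- `R` is stochastic, and its means of nonnegative block-increasing functions are at most those
of `S`. -/
structure OrderDominated {d : ℕ} (R S : Matrix (State d) (State d) ℝ) : Prop where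
  stochastic : IsStochastic R
  mean_le : ∀ (x : State d) (f : State d → ℝ), IsBlockIncreasing f → (∀ y, 0 ≤ f y) →
    (Summable fun y => S x y * f y) →
      (Summable fun y => R x y * f y) ∧ mean (R x) f ≤ mean (S x) f

/-- The action of a matrix on column vectors. -/
noncomputable def push {d : ℕ} (R : Matrix (State d) (State d) ℝ) (f : State d → ℝ) :
    State d → ℝ := fun x => mean (R x) f

variable {d : ℕ} {P R S : Matrix (State d) (State d) ℝ} {v f : State d → ℝ}

theorem BlockDominated.orderDominated (hP : IsStochastic P) (hS : IsStochastic S)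
    (h : BlockDominated P S) : OrderDominated P S :=
  ⟨hP, fun x _ hf hf0 hs =>
    mean_le_mean_of_tail_le (hP.isProb x) (hS.isProb x) (h x) hf hf0 hs⟩

theorem IsBlockMonotone.mean_mono (hS : IsBlockMonotone S) (hf : IsBlockIncreasing f)
    (hf0 : ∀ y, 0 ≤ f y) (hs : ∀ x, Summable fun y => S x y * f y) :
    IsBlockIncreasing (push S f) := fun k i =>
  (mean_le_mean_of_tail_le (hS.stochastic.isProb (k, i)) (hS.stochastic.isProb (k + 1, i))
    (fun l j => hS.mono k l i j) hf hf0 (hs _)).2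

/-- Capping the level can only lower a block-increasing function, so every estimate for dominated
kernels applies to the truncation as well. -/
theorem OrderDominated.lastColTrunc (h : OrderDominated P S) (n : ℕ) :
    OrderDominated (lastColTrunc n P) S := by
  refine ⟨isStochastic_lastColTrunc h.stochastic n, fun x f hf hf0 hs => ?_⟩
  have hcap : ∀ y, f (cap n y) ≤ f y := fun y => hf.monotone y.2 (min_le_left _ _)
  obtain ⟨h1, h2⟩ := h.mean_le x f hf hf0 hs
  have h3 : Summable fun y => P x y * f (cap n y) :=
    summable_mul_of_abs_le (h.stochastic.nonneg x) h1 fun y => by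
      rw [abs_of_nonneg (hf0 _)]
      exact hcap y
  have h4 := hasSum_lastColTrunc n x h3
  exact ⟨h4.summable, h4.tsum_eq.trans_le
    ((BlockMC.mean_mono (h.stochastic.nonneg x) h3 h1 hcap).trans h2)⟩

theorem OrderDominated.drift (h : OrderDominated R S) {γ b : ℝ} {K : ℕ}
    (hv : IsBlockIncreasing v) (hv0 : ∀ x, 0 ≤ v x) (hd : Drift S v γ b K) :
    Drift R v γ b K := fun x =>
  have h1 := h.mean_le x v hv hv0 (hd x).1
  ⟨h1.1, h1.2.trans (hd x).2⟩

theorem abs_push_iterate_le (hR : IsStochastic R) {C : ℝ} (hf : ∀ y, |f y| ≤ C) (m : ℕ) :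
    ∀ x, |(push R)^[m] f x| ≤ C := by
  induction m with
  | zero => simpa using hf
  | succ m ih =>
    intro x
    rw [Function.iterate_succ_apply']
    exact (hR.isProb x).abs_mean_le ih

/-! ### Running maxima and geometric decay of oscillations -/

/-- Running maximum along the levels, phase by phase. -/
noncomputable def runMax {d : ℕ} (h : State d → ℝ) (y : State d) : ℝ :=
  partialSups (fun l => h (l, y.2)) y.1

theorem le_runMax (h : State d → ℝ) {l k : ℕ} (hl : l ≤ k) (j : Fin d) :
    h (l, j) ≤ runMax h (k, j) :=
  le_partialSups_of_le (fun l => h (l, j)) hl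

theorem exists_runMax_eq (h : State d → ℝ) (k : ℕ) (j : Fin d) :
    ∃ l ≤ k, runMax h (k, j) = h (l, j) := by
  obtain ⟨l, hl, h'⟩ := exists_partialSups_eq (fun l => h (l, j)) k
  exact ⟨l, hl, h'⟩

theorem isBlockIncreasing_runMax (h : State d → ℝ) : IsBlockIncreasing (runMax h) := fun k j =>
  (partialSups (fun l => h (l, j))).monotone k.le_succ

theorem abs_runMax_le {h : State d → ℝ} {C : ℝ} (hh : ∀ y, |h y| ≤ C) (y : State d) :
    |runMax h y| ≤ C := by
  obtain ⟨l, -, hl⟩ := exists_runMax_eq h y.1 y.2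
  rw [show runMax h y = h (l, y.2) from hl]
  exact hh _

/-- Bounded functions have their means bounded by the dominating mean of the running maximum at
any higher level. -/
theorem push_le_push_runMax (hS : IsBlockMonotone S) (hR : OrderDominated R S) {h : State d → ℝ}
    {C : ℝ} (hh : ∀ y, |h y| ≤ C) {l k : ℕ} (hl : l ≤ k) (i : Fin d) :
    push R h (l, i) ≤ push S (runMax h) (k, i) := by
  have hM := abs_runMax_le hh
  -- Shifting by `C` makes the running maximum nonnegative; the shift cancels since rows sum to one.
  have hb : ∀ y, |runMax h y + C| ≤ C + |C| := fun y =>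
    (abs_add_le _ _).trans (add_le_add_left (hM y) _)
  have hinc : IsBlockIncreasing fun y => runMax h y + C := fun k j =>
    add_le_add_left (isBlockIncreasing_runMax h k j) C
  have hnn : ∀ y, 0 ≤ runMax h y + C := fun y => by linarith [(abs_le.1 (hM y)).1]
  have hsS := fun x => (hS.stochastic.isProb x).summable_mul hb
  have h1 := (hR.mean_le (l, i) _ hinc hnn (hsS _)).2
  have h2 := (hS.mean_mono hinc hnn hsS).monotone i hl
  have h3 : push R h (l, i) ≤ mean (R (l, i)) (runMax h) :=
    BlockMC.mean_mono (hR.stochastic.nonneg _) ((hR.stochastic.isProb _).summable_mul hh)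
      ((hR.stochastic.isProb _).summable_mul hM) fun y => le_runMax h le_rfl y.2
  rw [mean_add ((hR.stochastic.isProb _).summable_mul hM)
    ((hR.stochastic.isProb _).summable_const C), (hR.stochastic.isProb _).mean_const] at h1
  simp only [push] at h2
  rw [mean_add ((hS.stochastic.isProb _).summable_mul hM)
    ((hS.stochastic.isProb _).summable_const C), (hS.stochastic.isProb _).mean_const] at h1 h2
  rw [mean_add ((hS.stochastic.isProb _).summable_mul hM)
    ((hS.stochastic.isProb _).summable_const C), (hS.stochastic.isProb _).mean_const] at h2
  simp only [push] at h3 ⊢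
  linarith

/-- The oscillation of the iterates over the levels `0, …, k` decays geometrically. -/
theorem push_iterate_sub_le (hS : IsBlockMonotone S) (hR : OrderDominated R S) {γ b : ℝ}
    (hγ : 0 ≤ γ) (hv : ∀ x, 1 ≤ v x) (hd : Drift S v γ b 0) (hf : ∀ y, |f y| ≤ 1) (m : ℕ) :
    ∀ (k k₁ k₂ : ℕ) (i : Fin d), k₁ ≤ k → k₂ ≤ k →
      (push R)^[m] f (k₁, i) - (push R)^[m] f (k₂, i) ≤ 2 * γ ^ m * v (k, i) := by
  induction m with
  | zero =>
    intro k k₁ k₂ i _ _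
    have h1 := abs_le.1 (hf (k₁, i))
    have h2 := abs_le.1 (hf (k₂, i))
    have h3 := hv (k, i)
    simp only [Function.iterate_zero, id, pow_zero]
    linarith [h1.2, h2.1]
  | succ m ih =>
    intro k k₁ k₂ i hk₁ hk₂
    -- At `k = 0`, where the drift has the extra `b`, both levels are zero and the difference
    -- vanishes.
    rcases Nat.eq_zero_or_pos k with rfl | hk
    · rw [Nat.le_zero.1 hk₁, Nat.le_zero.1 hk₂, sub_self]
      have := hv (0, i)
      positivity
    rw [Function.iterate_succ_apply']
    set h := (push R)^[m] f with hh
    have hb : ∀ y, |h y| ≤ 1 := abs_push_iterate_le hR.stochastic hf m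
    have hb' : ∀ y, |(-h) y| ≤ 1 := fun y => by simpa using hb y
    have h1 := push_le_push_runMax hS hR hb hk₁ i
    have h2 := push_le_push_runMax hS hR hb' hk₂ i
    have h3 : push R (-h) (k₂, i) = - push R h (k₂, i) := by
      simp only [push, mean, Pi.neg_apply, mul_neg, tsum_neg]
    have hp := hS.stochastic.isProb (k, i)
    have h4 : push S (runMax h) (k, i) + push S (runMax (-h)) (k, i) ≤
        2 * γ ^ m * mean (S (k, i)) v := by
      have hs1 := hp.summable_mul (abs_runMax_le hb)
      have hs2 := hp.summable_mul (abs_runMax_le hb')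
      rw [← mean_const_mul, push, push, ← mean_add hs1 hs2]
      refine BlockMC.mean_mono hp.nonneg (summable_mul_add hs1 hs2)
        (summable_mul_const_mul (hd _).1 _) fun y => ?_
      -- The running maxima of `h` and `-h` add up to the oscillation of `h` over levels `0, …,
      -- y.1`, to which the induction hypothesis applies.
      obtain ⟨l₁, hl₁, e₁⟩ := exists_runMax_eq h y.1 y.2
      obtain ⟨l₂, hl₂, e₂⟩ := exists_runMax_eq (-h) y.1 y.2
      have := ih y.1 l₁ l₂ y.2 hl₁ hl₂
      rw [show runMax h y = _ from e₁, show runMax (-h) y = _ from e₂, Pi.neg_apply]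
      linarith
    have h5 : mean (S (k, i)) v ≤ γ * v (k, i) := by
      simpa [hk.ne', mean] using (hd (k, i)).2
    have h6 : 2 * γ ^ m * mean (S (k, i)) v ≤ 2 * γ ^ m * (γ * v (k, i)) :=
      mul_le_mul_of_nonneg_left h5 (by positivity)
    rw [pow_succ]
    linarith

/-! ### Stationary means and the drift bound -/

section stationary

variable {π : State d → ℝ}

theorem IsStationary.isProb (hπ : IsStationary R π) : IsProb π := ⟨hπ.nonneg, hπ.hasSum_one⟩

/-- Exchange of the two summations of a bounded function against a finite measure and a kernel. -/
theorem tsum_mul_tsum_comm {α β : Type*} {a : α → ℝ} {r : α → β → ℝ} {φ : β → ℝ} {C : ℝ}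
    (ha0 : ∀ x, 0 ≤ a x) (ha : Summable a) (hr0 : ∀ x y, 0 ≤ r x y)
    (hr : ∀ x, HasSum (r x) 1) (hφ : ∀ y, |φ y| ≤ C) :
    ∑' x, a x * ∑' y, r x y * φ y = ∑' y, (∑' x, a x * r x y) * φ y := by
  have h0 : ∀ p : α × β, 0 ≤ a p.1 * r p.1 p.2 := fun p => mul_nonneg (ha0 _) (hr0 _ _)
  have hs : Summable fun p : α × β => a p.1 * r p.1 p.2 := by
    refine (summable_prod_of_nonneg h0).2 ⟨fun x => (hr x).summable.mul_left (a x), ?_⟩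
    change Summable fun x => ∑' y, a x * r x y
    simpa only [tsum_mul_left, (hr _).tsum_eq, mul_one] using ha
  have hs' : Summable fun p : α × β => a p.1 * r p.1 p.2 * φ p.2 := by
    refine Summable.of_norm_bounded (hs.mul_right C) fun p => ?_
    rw [Real.norm_eq_abs, abs_mul, abs_of_nonneg (h0 p)]
    exact mul_le_mul_of_nonneg_left (hφ _) (h0 p)
  have hc := Summable.tsum_comm (f := fun x y => a x * r x y * φ y) hs'
  simp only [← tsum_mul_left, ← tsum_mul_right, ← mul_assoc]
  exact hc.symm

theorem IsStationary.mean_push (hπ : IsStationary R π) (hR : IsStochastic R) {C : ℝ}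
    (hf : ∀ y, |f y| ≤ C) : mean π (push R f) = mean π f := by
  refine (tsum_mul_tsum_comm hπ.nonneg hπ.hasSum_one.summable hR.nonneg hR.hasSum_row hf).trans ?_
  exact tsum_congr fun y => by rw [(hπ.invariant y).tsum_eq]

theorem IsStationary.mean_push_iterate (hπ : IsStationary R π) (hR : IsStochastic R) {C : ℝ}
    (hf : ∀ y, |f y| ≤ C) (m : ℕ) : mean π ((push R)^[m] f) = mean π f := by
  induction m with
  | zero => rfl
  | succ m ih =>
    rw [Function.iterate_succ_apply', hπ.mean_push hR (abs_push_iterate_le hR hf m), ih]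

/-- The drift condition bounds the stationary mean of the drift function. -/
theorem IsStationary.mean_le_of_drift (hπ : IsStationary R π) (hR : IsStochastic R) {γ b : ℝ}
    {K : ℕ} (hγ0 : 0 ≤ γ) (hγ : γ < 1) (hb : 0 ≤ b) (hv : ∀ x, 0 ≤ v x) (hd : Drift R v γ b K) :
    (Summable fun x => π x * v x) ∧ mean π v ≤ b / (1 - γ) := by
  have key : ∀ s : Finset (State d), ∑ x ∈ s, π x * v x ≤ b / (1 - γ) := by
    intro s
    rw [le_div_iff₀ (sub_pos.2 hγ)]
    -- The mean of `v` is not yet known to be finite, so invariance is used for `min v N`; this `N`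
    -- leaves `v` unchanged on `s`.
    set N := ∑ x ∈ s, v x with hN
    have hN0 : 0 ≤ N := sum_nonneg fun x _ => hv x
    have hsN : ∀ x ∈ s, v x ≤ N := fun x hx => single_le_sum (fun x _ => hv x) hx
    have hb1 : ∀ y, |min (v y) N| ≤ N := fun y => by
      rw [abs_of_nonneg (le_min (hv y) hN0)]
      exact min_le_right _ _
    have hb2 : ∀ y, |min (γ * v y + b) N| ≤ N := fun y => by
      rw [abs_of_nonneg (le_min (add_nonneg (mul_nonneg hγ0 (hv y)) hb) hN0)]
      exact min_le_right _ _
    have h1 : ∀ x, push R (fun y => min (v y) N) x ≤ min (γ * v x + b) N := fun x => by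
      have hp := hR.isProb x
      refine le_min ?_ ((le_abs_self _).trans (hp.abs_mean_le hb1))
      refine (mean_mono hp.nonneg (hp.summable_mul hb1) (hd x).1 fun y =>
        min_le_left _ _).trans ((hd x).2.trans ?_)
      split_ifs
      · simp
      · simpa using hb
    have h2 : mean π (fun y => min (v y) N) ≤ mean π fun y => min (γ * v y + b) N := by
      rw [← hπ.mean_push hR hb1]
      exact mean_mono hπ.nonneg
        (hπ.isProb.summable_mul fun x => (hR.isProb x).abs_mean_le hb1)
        (hπ.isProb.summable_mul hb2) h1
    classical
    have hb3 : ∀ y, |if y ∈ s then (1 - γ) * v y else 0| ≤ (1 - γ) * N := fun y => by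
      have h0 : 0 ≤ 1 - γ := (sub_pos.2 hγ).le
      split_ifs with hy
      · rw [abs_of_nonneg (mul_nonneg h0 (hv y))]
        exact mul_le_mul_of_nonneg_left (hsN y hy) h0
      · rw [abs_zero]
        exact mul_nonneg h0 hN0
    -- The right integrand is at least `(1 - γ) v` where `v ≤ N`, hence on `s`, and is nonnegative
    -- elsewhere.
    have h3 : mean π (fun y => (if y ∈ s then (1 - γ) * v y else 0)) ≤
        mean π fun y => (min (v y) N - min (γ * v y + b) N) + b := by
      refine mean_mono hπ.nonneg (hπ.isProb.summable_mul hb3) ?_ fun y => ?_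
      · refine hπ.isProb.summable_mul (C := N + N + |b|) fun y => ?_
        exact (abs_add_le _ _).trans (add_le_add_left ((abs_sub _ _).trans
          (add_le_add (hb1 y) (hb2 y))) _)
      · split_ifs with hy
        · rw [min_eq_left (hsN y hy)]
          linarith [min_le_left (γ * v y + b) N]
        · rcases le_total (v y) N with hy' | hy'
          · rw [min_eq_left hy']
            nlinarith [min_le_left (γ * v y + b) N, hv y]
          · rw [min_eq_right hy']
            linarith [min_le_right (γ * v y + b) N]
    have h4 : mean π (fun y => (if y ∈ s then (1 - γ) * v y else 0)) =
        (1 - γ) * ∑ x ∈ s, π x * v x := by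
      rw [mean, tsum_eq_sum (s := s) fun y hy => by simp [hy], mul_sum]
      exact sum_congr rfl fun y hy => by rw [if_pos hy]; ring
    have hs1 := hπ.isProb.summable_mul hb1
    have hs2 := hπ.isProb.summable_mul hb2
    have hs3 : Summable fun y => π y * (min (v y) N - min (γ * v y + b) N) := by
      simpa only [mul_sub] using hs1.sub hs2
    rw [mean_add hs3 (hπ.isProb.summable_const b), mean_sub hs1 hs2,
      hπ.isProb.mean_const, h4] at h3
    linarith
  have hnn : ∀ x, 0 ≤ π x * v x := fun x => mul_nonneg (hπ.nonneg x) (hv x)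
  have hs := summable_of_sum_le hnn key
  exact ⟨hs, hs.tsum_le_of_sum_le key⟩

end stationary

end BlockMC

namespace BlockMC

open Finset

variable {d : ℕ} {P R S : Matrix (State d) (State d) ℝ} {v f π π₁ π₂ : State d → ℝ}

/-! ### The autonomous phase chain and uniqueness of its stationary law -/

section phases

/-- The phase marginal of a weight vector. -/
noncomputable def phaseMarginal {d : ℕ} (π : State d → ℝ) (i : Fin d) : ℝ := ∑' k : ℕ, π (k, i)

theorem abs_phase_le (φ : Fin d → ℝ) (j : Fin d) : |φ j| ≤ ∑ i, |φ i| :=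
  single_le_sum (f := fun i => |φ i|) (fun _ _ => abs_nonneg _) (mem_univ j)

theorem IsProb.mean_phase (hπ : IsProb π) (φ : Fin d → ℝ) :
    mean π (fun y => φ y.2) = ∑ i, phaseMarginal π i * φ i := by
  rw [mean, tsum_eq_sum_phases (hπ.summable_mul fun y => abs_phase_le φ y.2)]
  exact sum_congr rfl fun i _ => tsum_mul_right (f := fun k : ℕ => π (k, i)) (a := φ i)

theorem runMax_phase (φ : Fin d → ℝ) : runMax (fun y : State d => φ y.2) = fun y => φ y.2 := by
  ext y
  obtain ⟨l, -, h⟩ := exists_runMax_eq (fun y : State d => φ y.2) y.1 y.2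
  exact h

theorem IsStochastic.orderDominated_refl (hS : IsStochastic S) : OrderDominated S S :=
  ⟨hS, fun _ _ _ _ h => ⟨h, le_rfl⟩⟩

theorem push_phase_le (hS : IsBlockMonotone S) (hR : OrderDominated R S) (φ : Fin d → ℝ)
    {l k : ℕ} (hl : l ≤ k) (i : Fin d) :
    push R (fun y => φ y.2) (l, i) ≤ push S (fun y => φ y.2) (k, i) := by
  have h := push_le_push_runMax hS hR (h := fun y => φ y.2) (fun y => abs_phase_le φ y.2) hl i
  rwa [runMax_phase] at h

/-- A function of the phase alone is constant along levels, so the order applies to both `φ` and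
`-φ`. -/
theorem push_phase_eq (hS : IsBlockMonotone S) (hR : OrderDominated R S) (φ : Fin d → ℝ)
    {l k : ℕ} (hl : l ≤ k) (i : Fin d) :
    push R (fun y => φ y.2) (l, i) = push S (fun y => φ y.2) (k, i) := by
  refine le_antisymm (push_phase_le hS hR φ hl i) ?_
  have h := push_phase_le hS hR (fun j => - φ j) hl i
  simpa only [push, mean, mul_neg, tsum_neg, neg_le_neg_iff] using h

/-- The phase process is autonomous, with the same transition law for `R` and `S`. -/
theorem push_phase_eq_zero_level (hS : IsBlockMonotone S) (hR : OrderDominated R S)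
    (φ : Fin d → ℝ) (x : State d) :
    push R (fun y => φ y.2) x = push S (fun y => φ y.2) (0, x.2) :=
  (push_phase_eq hS hR φ le_rfl x.2).trans
    (push_phase_eq hS hS.stochastic.orderDominated_refl φ x.1.zero_le x.2).symm

theorem IsStationary.phaseMarginal_invariant (hS : IsBlockMonotone S) (hR : OrderDominated R S)
    (hπ : IsStationary R π) (φ : Fin d → ℝ) :
    ∑ i, phaseMarginal π i * φ i =
      ∑ i, phaseMarginal π i * push S (fun y => φ y.2) (0, i) := by
  rw [← hπ.isProb.mean_phase, ← hπ.mean_push hR.stochastic fun y => abs_phase_le φ y.2,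
    ← hπ.isProb.mean_phase fun i => push S (fun y => φ y.2) (0, i)]
  congr 1
  ext x
  exact push_phase_eq_zero_level hS hR φ x

theorem IsProb.sum_phaseMarginal (hπ : IsProb π) : ∑ i, phaseMarginal π i = 1 := by
  rw [← hπ.hasSum_one.tsum_eq, tsum_eq_sum_phases hπ.hasSum_one.summable]
  rfl

theorem mem_of_path {A : Fin d → Prop}
    (hA : ∀ x y : State d, 0 < S x y → A x.2 → A y.2) {x y : State d}
    (p : @Quiver.Path _ S.toQuiver x y) (hx : A x.2) : A y.2 := by
  let := S.toQuiver
  induction p with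
  | nil => exact hx
  | cons _ e ih => exact hA _ _ e.down ih

/-- Phase marginals of stationary vectors of dominated matrices agree when the dominating matrix is
irreducible. -/
theorem phaseMarginal_eq {R₁ R₂ : Matrix (State d) (State d) ℝ} (hS : IsBlockMonotone S)
    (hirr : S.IsIrreducible) (h₁ : OrderDominated R₁ S) (h₂ : OrderDominated R₂ S)
    (hπ₁ : IsStationary R₁ π₁) (hπ₂ : IsStationary R₂ π₂) :
    phaseMarginal π₁ = phaseMarginal π₂ := by
  classical
  set w : Fin d → ℝ := fun i => phaseMarginal π₁ i - phaseMarginal π₂ i with hw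
  have hw0 : ∑ i, w i = 0 := by
    rw [hw, sum_sub_distrib, hπ₁.isProb.sum_phaseMarginal, hπ₂.isProb.sum_phaseMarginal, sub_self]
  -- The indicator of the set where `w > 0`. Invariance of `w` tested on it is a sum of nonnegative
  -- terms equal to zero, so this set of phases cannot be left; by irreducibility it is empty or
  -- everything, and `∑ i, w i = 0` excludes the latter.
  set φ : Fin d → ℝ := fun i => if 0 < w i then 1 else 0 with hφ
  set ψ : Fin d → ℝ := fun i => push S (fun y => φ y.2) (0, i) with hψ
  have hφ1 : ∀ i, |φ i| ≤ 1 := fun i => by simp only [hφ]; split_ifs <;> simp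
  have hφ0 : ∀ i, 0 ≤ φ i := fun i => by simp only [hφ]; split_ifs <;> simp
  have hψ1 : ∀ i, ψ i ≤ 1 := fun i =>
    (le_abs_self _).trans ((hS.stochastic.isProb _).abs_mean_le fun y => hφ1 y.2)
  have hψ0 : ∀ i, 0 ≤ ψ i := fun i =>
    tsum_nonneg fun y => mul_nonneg (hS.stochastic.nonneg _ _) (hφ0 y.2)
  have hinv : ∑ i, (w i * φ i - w i * ψ i) = 0 := by
    have e₁ := hπ₁.phaseMarginal_invariant hS h₁ φ
    have e₂ := hπ₂.phaseMarginal_invariant hS h₂ φ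
    simp only [hw, sub_mul, sum_sub_distrib]
    linarith
  have hterm : ∀ i, 0 ≤ w i * φ i - w i * ψ i := fun i => by
    rcases lt_or_ge 0 (w i) with hi | hi
    · have : φ i = 1 := if_pos hi
      nlinarith [hψ1 i]
    · have : φ i = 0 := if_neg hi.not_gt
      nlinarith [hψ0 i]
  have hzero := (sum_eq_zero_iff_of_nonneg fun i _ => hterm i).1 hinv
  have hclosed : ∀ x y : State d, 0 < S x y → 0 < w x.2 → 0 < w y.2 := by
    intro x y hxy hx
    have h1 : ψ x.2 = 1 := by
      have h := hzero x.2 (mem_univ _)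
      rw [show φ x.2 = 1 from if_pos hx, ← mul_sub] at h
      linarith [(mul_eq_zero.1 h).resolve_left hx.ne']
    simp only [hψ] at h1
    rw [← push_phase_eq_zero_level hS hS.stochastic.orderDominated_refl φ x] at h1
    have hp := hS.stochastic.isProb x
    have hs := hp.summable_mul fun y => hφ1 y.2
    have h2 : ∑' z, (S x z - S x z * φ z.2) = 0 := by
      rw [hp.hasSum_one.summable.tsum_sub hs, hp.hasSum_one.tsum_eq]
      exact sub_eq_zero.2 h1.symm
    have h3 : ∀ z, 0 ≤ S x z - S x z * φ z.2 := fun z => by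
      nlinarith [hp.nonneg z, (abs_le.1 (hφ1 z.2)).2]
    have h4 := congrFun ((hasSum_zero_iff_of_nonneg h3).1
      (h2 ▸ (hp.hasSum_one.summable.sub hs).hasSum)) y
    by_contra hy
    simp only [hφ, if_neg hy, Pi.zero_apply] at h4
    linarith
  have hle : ∀ i, w i ≤ 0 := by
    by_contra! h
    obtain ⟨i, hi⟩ := h
    have hall : ∀ j, 0 < w j := fun j => by
      obtain ⟨p, -⟩ := hirr.connected (0, i) (0, j)
      exact mem_of_path (A := fun j => 0 < w j) hclosed p hi
    exact (sum_pos (fun j _ => hall j) ⟨i, mem_univ i⟩).ne' hw0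
  have hz := (sum_eq_zero_iff_of_nonpos fun i _ => hle i).1 hw0
  ext i
  exact sub_eq_zero.1 (hz i (mem_univ i))

end phases

/-! ### Comparison with the truncation -/

/-- Iterates of `P` and of its truncation differ by a multiple of the drift function. -/
theorem abs_iterate_lastColTrunc_sub_le (hP : IsStochastic P) {γ b T : ℝ} (hγ0 : 0 ≤ γ)
    (hγ : γ < 1) (hb : 0 ≤ b) (hv : ∀ x, 0 ≤ v x) (hd : Drift P v γ b 0) {n : ℕ} (hT : 0 ≤ T)
    (hTv : ∀ k, n < k → ∀ i, 1 ≤ T * v (k, i)) (hf : ∀ y, |f y| ≤ 1) (m : ℕ) :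
    ∃ α, 0 ≤ α ∧ ∀ x, |(push (lastColTrunc n P))^[m] f x - (push P)^[m] f x| ≤
      2 * T * (α * v x + b / (1 - γ) * (m - α)) := by
  induction m with
  | zero => exact ⟨0, le_rfl, fun x => by simp⟩
  | succ m ih =>
    obtain ⟨α, hα, ih⟩ := ih
    -- Capping adds `v` to the bracket, and the drift turns `(1 + α) v` into `(1 + α)(γ v + b)`.
    -- With `b = C (1 - γ)` the form `α v + C (m - α)` is preserved. Once the mean of `v` is bounded
    -- by `C`, the bracket is at most `C m`, whatever `α` is.
    refine ⟨γ * (1 + α), by positivity, fun x => ?_⟩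
    rw [Function.iterate_succ_apply', Function.iterate_succ_apply']
    set g := (push (lastColTrunc n P))^[m] f with hg
    set h := (push P)^[m] f with hh
    set C := b / (1 - γ) with hC
    have hbC : b = C * (1 - γ) := by rw [hC, div_mul_cancel₀ _ (sub_pos.2 hγ).ne']
    have hg1 : ∀ y, |g y| ≤ 1 := abs_push_iterate_le (isStochastic_lastColTrunc hP n) hf m
    have hh1 : ∀ y, |h y| ≤ 1 := abs_push_iterate_le hP hf m
    have hp := hP.isProb x
    have hs1 : Summable fun y => P x y * g (cap n y) := hp.summable_mul fun y => hg1 _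
    have hs2 := hp.summable_mul hh1
    have e1 : push (lastColTrunc n P) g x = mean (P x) fun y => g (cap n y) :=
      (hasSum_lastColTrunc n x hs1).tsum_eq
    have hs3 : Summable fun y => P x y * (2 * T * (1 + α) * v y) :=
      summable_mul_const_mul (hd x).1 _
    have hs4 := hp.summable_const (2 * T * (C * (m - α)))
    have hpt : ∀ y, |g (cap n y) - h y| ≤
        2 * T * (1 + α) * v y + 2 * T * (C * (m - α)) := by
      intro y
      have h1 : |g (cap n y) - g y| ≤ 2 * (T * v y) := by
        rcases le_or_gt y.1 n with hy | hy
        · have : cap n y = y := Prod.ext (min_eq_left hy) rfl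
          rw [this, sub_self, abs_zero]
          have := hv y
          positivity
        · have h1 := hTv y.1 hy y.2
          have h2 := (abs_sub (g (cap n y)) (g y)).trans (add_le_add (hg1 _) (hg1 _))
          rw [Prod.mk.eta] at h1
          linarith
      have h2 := abs_sub_le (g (cap n y)) (g y) (h y)
      have h3 := ih y
      linarith
    rw [e1, push, ← mean_sub hs1 hs2]
    refine (abs_mean_le_mean hp.nonneg (summable_mul_add hs3 hs4) hpt).trans ?_
    rw [mean_add hs3 hs4, mean_const_mul, hp.mean_const]
    have h5 : mean (P x) v ≤ γ * v x + b := by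
      refine (hd x).2.trans ?_
      split_ifs
      · simp
      · simpa using hb
    have h6 : 2 * T * (1 + α) * mean (P x) v ≤ 2 * T * (1 + α) * (γ * v x + b) :=
      mul_le_mul_of_nonneg_left h5 (by positivity)
    refine (add_le_add_left h6 _).trans_eq ?_
    rw [hbC]
    push_cast
    ring

/-- The iterates started from a stationary vector and from its projection to level zero. -/
theorem IsStationary.abs_mean_sub_level_zero_le (hπ : IsStationary R π) (hS : IsBlockMonotone S)
    (hR : OrderDominated R S) {γ b : ℝ} (hγ0 : 0 ≤ γ) (hv : ∀ x, 1 ≤ v x)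
    (hd : Drift S v γ b 0) (hf : ∀ y, |f y| ≤ 1)
    (hπv : Summable fun x => π x * v x) (m : ℕ) :
    |mean π f - mean π (fun y => (push R)^[m] f (0, y.2))| ≤ 2 * γ ^ m * mean π v := by
  have hb := abs_push_iterate_le hR.stochastic hf m
  rw [← hπ.mean_push_iterate hR.stochastic hf m, ← mean_sub (hπ.isProb.summable_mul hb)
    (hπ.isProb.summable_mul fun y => hb _), ← mean_const_mul]
  refine abs_mean_le_mean hπ.nonneg (summable_mul_const_mul hπv _) fun y => abs_le.2 ⟨?_, ?_⟩
  · have := push_iterate_sub_le hS hR hγ0 hv hd hf m y.1 0 y.1 y.2 y.1.zero_le le_rfl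
    linarith
  · exact push_iterate_sub_le hS hR hγ0 hv hd hf m y.1 y.1 0 y.2 le_rfl y.1.zero_le

/-- The sign of `μ - η` attains the total variation norm. -/
theorem exists_abs_le_one_tvDist_eq {μ η : State d → ℝ} (hμ : IsProb μ) (hη : IsProb η) :
    ∃ f : State d → ℝ, (∀ y, |f y| ≤ 1) ∧ tvDist μ η = mean μ f - mean η f := by
  have hf : ∀ y, |(if 0 ≤ μ y - η y then (1 : ℝ) else -1)| ≤ 1 := fun y => by
    split_ifs <;> simp
  refine ⟨fun y => if 0 ≤ μ y - η y then 1 else -1, hf, ?_⟩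
  rw [mean, mean, ← (hμ.summable_mul hf).tsum_sub (hη.summable_mul hf), tvDist]
  refine tsum_congr fun y => ?_
  split_ifs with h
  · rw [abs_of_nonneg h]; ring
  · rw [abs_of_neg (not_le.1 h)]; ring

/-- The error bound under a drift condition to level zero. -/
theorem tvDist_lastColTrunc_le (hS : IsBlockMonotone S) (hirr : S.IsIrreducible)
    (hP : OrderDominated P S) {γ b : ℝ} (hγ0 : 0 ≤ γ) (hγ : γ < 1) (hb : 0 ≤ b)
    (hv : ∀ x, 1 ≤ v x) (hvi : IsBlockIncreasing v) (hd : Drift S v γ b 0)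
    (hπ : IsStationary P π) (n : ℕ) {πn : State d → ℝ}
    (hπn : IsStationary (lastColTrunc n P) πn) (m : ℕ) :
    tvDist πn π ≤ b / (1 - γ) * (4 * γ ^ m + 2 * m * ∑ i : Fin d, 1 / v (n, i)) := by
  have hQ := hP.lastColTrunc n
  have hv0 : ∀ x, 0 ≤ v x := fun x => zero_le_one.trans (hv x)
  have hdP := hP.drift hvi hv0 hd
  obtain ⟨hs, hC⟩ := hπ.mean_le_of_drift hP.stochastic hγ0 hγ hb hv0 hdP
  obtain ⟨hsn, hCn⟩ := hπn.mean_le_of_drift hQ.stochastic hγ0 hγ hb hv0 (hQ.drift hvi hv0 hd)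
  obtain ⟨f, hf, htv⟩ := exists_abs_le_one_tvDist_eq hπn.isProb hπ.isProb
  have h1 := hπ.abs_mean_sub_level_zero_le hS hP hγ0 hv hd hf hs m
  have h2 := hπn.abs_mean_sub_level_zero_le hS hQ hγ0 hv hd hf hsn m
  set T : ℝ := ∑ i : Fin d, 1 / v (n, i) with hT
  have hT0 : 0 ≤ T := sum_nonneg fun i _ => one_div_nonneg.2 (hv0 _)
  have hTv : ∀ k, n < k → ∀ i, 1 ≤ T * v (k, i) := fun k hk i => by
    have hpos : 0 < v (n, i) := zero_lt_one.trans_le (hv _)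
    have h3 : 1 / v (n, i) ≤ T :=
      single_le_sum (f := fun i => 1 / v (n, i)) (fun i _ => one_div_nonneg.2 (hv0 _))
        (mem_univ i)
    calc (1 : ℝ) = 1 / v (n, i) * v (n, i) := (one_div_mul_cancel hpos.ne').symm
      _ ≤ T * v (k, i) := mul_le_mul h3 (hvi.monotone i hk.le) hpos.le hT0
  obtain ⟨α, hα, hdiff⟩ :=
    abs_iterate_lastColTrunc_sub_le hP.stochastic hγ0 hγ hb hv0 hdP hT0 hTv hf m
  set gQ := (push (lastColTrunc n P))^[m] f with hgQ
  set gP := (push P)^[m] f with hgP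
  have hbQ : ∀ y, |gQ y| ≤ 1 := abs_push_iterate_le hQ.stochastic hf m
  have hbP : ∀ y, |gP y| ≤ 1 := abs_push_iterate_le hP.stochastic hf m
  -- Both integrands see only the phase, whose law is the same under `πn` and `π`.
  have e : mean πn (fun y => gQ (0, y.2)) = mean π (fun y => gQ (0, y.2)) := by
    rw [hπn.isProb.mean_phase fun i => gQ (0, i), hπ.isProb.mean_phase fun i => gQ (0, i),
      phaseMarginal_eq hS hirr hQ hP hπn hπ]
  have h3 : |mean π (fun y => gQ (0, y.2)) - mean π (fun y => gP (0, y.2))| ≤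
      2 * T * (α * mean π v + b / (1 - γ) * (m - α)) := by
    have hp := hπ.isProb
    have hs3 : Summable fun y => π y * (2 * T * α * v y) := summable_mul_const_mul hs _
    have hs4 := hp.summable_const (2 * T * (b / (1 - γ) * (m - α)))
    rw [← mean_sub (hp.summable_mul fun y => hbQ _) (hp.summable_mul fun y => hbP _)]
    refine (abs_mean_le_mean hp.nonneg (summable_mul_add hs3 hs4) fun y => ?_).trans_eq ?_
    · refine (hdiff (0, y.2)).trans ?_
      have h4 : 2 * T * α * v (0, y.2) ≤ 2 * T * α * v y :=
        mul_le_mul_of_nonneg_left (hvi.monotone y.2 y.1.zero_le) (by positivity)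
      linarith
    · rw [mean_add hs3 hs4, mean_const_mul, hp.mean_const]
      ring
  have h4 : 2 * T * α * mean π v ≤ 2 * T * α * (b / (1 - γ)) :=
    mul_le_mul_of_nonneg_left hC (by positivity)
  have h5 : 2 * γ ^ m * mean π v ≤ 2 * γ ^ m * (b / (1 - γ)) :=
    mul_le_mul_of_nonneg_left hC (by positivity)
  have h6 : 2 * γ ^ m * mean πn v ≤ 2 * γ ^ m * (b / (1 - γ)) :=
    mul_le_mul_of_nonneg_left hCn (by positivity)
  rw [htv]
  rw [e] at h2
  have a1 := (abs_le.1 h1).1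
  have a2 := (abs_le.1 h2).2
  have a3 := (abs_le.1 h3).2
  linarith

/-! ### Moving the exceptional set to level zero -/

section drift

/-- The mean of the indicator of level zero. -/
theorem mean_level_zero (a : State d → ℝ) :
    mean a (fun y => if y.1 = 0 then 1 else 0) = ∑ j, a (0, j) := by
  refine (hasSum_of_phases fun j => ?_).tsum_eq
  simpa using hasSum_single (f := fun k : ℕ => a (k, j) * if k = 0 then 1 else 0) 0
    fun k hk => by simp [hk]

/-- The indicator of the positive levels is block-increasing, so its mean grows with the level. -/
theorem IsBlockMonotone.row_level_zero_antitone (hS : IsBlockMonotone S) (i : Fin d) :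
    Antitone fun k : ℕ => ∑ j, S (k, i) (0, j) := by
  have hb : ∀ y : State d, |(if y.1 = 0 then (1 : ℝ) else 0)| ≤ 1 := fun y => by
    split_ifs <;> simp
  have hb' : ∀ y : State d, |1 - (if y.1 = 0 then (1 : ℝ) else 0)| ≤ 1 := fun y => by
    split_ifs <;> simp
  have h := (hS.mean_mono (f := fun y => 1 - if y.1 = 0 then 1 else 0)
    (fun k i => by simp only [Nat.succ_ne_zero, if_false]; split_ifs <;> simp)
    (fun y => by split_ifs <;> simp)
    fun x => (hS.stochastic.isProb x).summable_mul hb').monotone i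
  intro k l hkl
  have hkl' := h hkl
  simp only [push] at hkl'
  rw [mean_sub ((hS.stochastic.isProb _).summable_const 1)
    ((hS.stochastic.isProb _).summable_mul hb), mean_sub
    ((hS.stochastic.isProb _).summable_const 1) ((hS.stochastic.isProb _).summable_mul hb),
    (hS.stochastic.isProb _).mean_const, (hS.stochastic.isProb _).mean_const,
    mean_level_zero, mean_level_zero] at hkl'
  simp only
  linarith

/-- A drift condition to the levels `0, …, K` is turned into one to level zero by raising the drift
function by a constant on the positive levels. -/
theorem Drift.to_level_zero (hS : IsBlockMonotone S) {v' : State d → ℝ} (hv' : ∀ x, 1 ≤ v' x)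
    {γ' b' B : ℝ} {K : ℕ} (hγ' : γ' < 1) (hd : Drift S v' γ' b' K) (hB : 0 < B)
    (hBrow : ∀ i, b' ≤ B * ∑ j, S (K, i) (0, j))
    (hv0 : ∀ i, v (0, i) = v' (0, i)) (hv : ∀ k, 1 ≤ k → ∀ i, v (k, i) = v' (k, i) + B) :
    Drift S v ((γ' + B) / (1 + B)) (b' + B) 0 := by
  rintro ⟨k, i⟩
  have hp := hS.stochastic.isProb (k, i)
  have hb : ∀ y : State d, |(if y.1 = 0 then (1 : ℝ) else 0)| ≤ 1 := fun y => by
    split_ifs <;> simp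
  have hve : v = fun y => (v' y + B) - B * (if y.1 = 0 then 1 else 0) := by
    ext ⟨l, j⟩
    rcases Nat.eq_zero_or_pos l with rfl | hl
    · simp [hv0]
    · simp [hv l hl, hl.ne']
  have hs1 := (hd (k, i)).1
  have hs2 := summable_mul_add hs1 (hp.summable_const B)
  have hs3 := summable_mul_const_mul (hp.summable_mul hb) B
  have hs : Summable fun y => S (k, i) y * v y := by
    rw [hve]
    simpa only [mul_sub] using hs2.sub hs3
  have hmean : mean (S (k, i)) v = mean (S (k, i)) v' + B - B * ∑ j, S (k, i) (0, j) := by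
    rw [hve, mean_sub hs2 hs3, mean_add hs1 (hp.summable_const B), hp.mean_const,
      mean_const_mul, mean_level_zero]
  refine ⟨hs, ?_⟩
  change mean (S (k, i)) v ≤ _
  have hle : mean (S (k, i)) v' ≤ _ := (hd (k, i)).2
  have hB1 : 0 < 1 + B := by linarith
  have hz : 0 ≤ B * ∑ j, S (k, i) (0, j) :=
    mul_nonneg hB.le (sum_nonneg fun j _ => hS.stochastic.nonneg _ _)
  have hγ : γ' ≤ (γ' + B) / (1 + B) := by
    rw [le_div_iff₀ hB1]
    nlinarith
  rw [hmean]
  rcases Nat.eq_zero_or_pos k with rfl | hk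
  · rw [hv0]
    simp only [Nat.zero_le, le_refl, if_true, mul_one] at hle ⊢
    have := mul_le_mul_of_nonneg_right hγ (zero_le_one.trans (hv' (0, i)))
    linarith
  · rw [hv k hk]
    simp only [Nat.le_zero, hk.ne', if_false, mul_zero, add_zero]
    -- For `1 ≤ k ≤ K` a jump to level zero is at least as likely as from level `K`, so the saving
    -- of `B` there pays for `b'`.
    have h1 : mean (S (k, i)) v' - B * ∑ j, S (k, i) (0, j) ≤ γ' * v' (k, i) := by
      split_ifs at hle with hK
      · have h2 := mul_le_mul_of_nonneg_left (hS.row_level_zero_antitone i hK) hB.le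
        have h3 := hBrow i
        simp only at h2
        linarith
      · linarith
    -- After clearing `1 + B` the gap is exactly `B (1 - γ') (v' - 1)`; this is where `v' ≥ 1`
    -- enters and what fixes `γ`.
    have h4 : γ' * v' (k, i) + B ≤ (γ' + B) / (1 + B) * (v' (k, i) + B) := by
      rw [div_mul_eq_mul_div, le_div_iff₀ hB1]
      nlinarith [mul_nonneg hB.le (mul_nonneg (sub_nonneg.2 hγ'.le) (sub_nonneg.2 (hv' (k, i))))]
    linarith

end drift

end BlockMC

/-! ### The choice of `B` and the conclusion -/

theorem mainTheorem3 {d : ℕ}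
    (P Pt : Matrix (BlockMC.State d) (BlockMC.State d) ℝ)
    (hP : BlockMC.IsStochastic P)
    (hPt_mono : BlockMC.IsBlockMonotone Pt)
    (hPt_irr : Pt.IsIrreducible)
    (hdom : BlockMC.BlockDominated P Pt)
    (v' : BlockMC.State d → ℝ)
    (hv'_incr : BlockMC.IsBlockIncreasing v')
    (hv'_one : ∀ x, 1 ≤ v' x)
    (γ' b' : ℝ) (K : ℕ)
    (hγ'_pos : 0 < γ') (hγ'_lt : γ' < 1) (hb' : 0 < b')
    (hdrift : BlockMC.Drift Pt v' γ' b' K)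
    (hrow : ∀ i : Fin d, 0 < ∑ j : Fin d, Pt (K, i) (0, j)) :
    (∃ B : ℝ, 0 < B ∧ ∀ i : Fin d, b' ≤ B * ∑ j : Fin d, Pt (K, i) (0, j)) ∧
    ∀ B : ℝ, 0 < B → (∀ i : Fin d, b' ≤ B * ∑ j : Fin d, Pt (K, i) (0, j)) →
      ∀ (γ b : ℝ) (v : BlockMC.State d → ℝ),
        γ = (γ' + B) / (1 + B) →
        b = b' + B →
        (∀ i : Fin d, v (0, i) = v' (0, i)) →
        (∀ k : ℕ, 1 ≤ k → ∀ i : Fin d, v (k, i) = v' (k, i) + B) →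
        ∀ π : BlockMC.State d → ℝ, BlockMC.IsStationary P π →
        ∀ n : ℕ, 1 ≤ n →
        ∀ πn : BlockMC.State d → ℝ, BlockMC.IsStationary (BlockMC.lastColTrunc n P) πn →
        ∀ m : ℕ, 1 ≤ m →
          BlockMC.tvDist πn π ≤
            b / (1 - γ) * (4 * γ ^ m + 2 * m * ∑ i : Fin d, 1 / v (n, i)) := by
  refine ⟨?_, ?_⟩
  · have hq : ∀ i ∈ (Finset.univ : Finset (Fin d)), 0 ≤ b' / ∑ j : Fin d, Pt (K, i) (0, j) :=
      fun i _ => (div_pos hb' (hrow i)).le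
    -- The sum dominates each required quotient; the `+ 1` keeps it positive even when `d = 0`.
    refine ⟨∑ i : Fin d, b' / ∑ j : Fin d, Pt (K, i) (0, j) + 1,
      add_pos_of_nonneg_of_pos (Finset.sum_nonneg hq) one_pos, fun i => ?_⟩
    rw [← div_le_iff₀ (hrow i)]
    exact (Finset.single_le_sum hq (Finset.mem_univ i)).trans (le_add_of_nonneg_right zero_le_one)
  · rintro B hB hBrow γ b v rfl rfl hv0 hv π hπ n _ πn hπn m _
    have hB1 : 0 < 1 + B := by linarith
    have hv1 : ∀ x, 1 ≤ v x := by
      rintro ⟨k, i⟩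
      rcases Nat.eq_zero_or_pos k with rfl | hk
      · rw [hv0]
        exact hv'_one _
      · rw [hv k hk]
        linarith [hv'_one (k, i)]
    have hvi : BlockMC.IsBlockIncreasing v := by
      intro k i
      rw [hv (k + 1) k.succ_pos]
      rcases Nat.eq_zero_or_pos k with rfl | hk
      · rw [hv0]
        linarith [hv'_incr 0 i]
      · rw [hv k hk]
        linarith [hv'_incr k i]
    refine BlockMC.tvDist_lastColTrunc_le hPt_mono hPt_irr
      (hdom.orderDominated hP hPt_mono.stochastic) (by positivity) ?_ (by positivity) hv1 hvi
      (hdrift.to_level_zero hPt_mono hv'_one hγ'_lt hB hBrow hv0 hv) hπ n hπn m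
    rw [div_lt_one hB1]
    linarith
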